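/- For an integer $n\ge 5$ let $R(g^{2}_{(n,1)},2)$ be the complex Lie algebra with basis $e_1,\dots,e_n,x,y$ and products $$[e_1,e_i]=e_{i+1}\ (2\le i\le n-2),\qquad [e_i,e_n]=e_{i+2}\ (2\le i\le n-3),$$ $$[e_1,x]=e_1,\qquad [e_i,x]=(i-2)e_i,\quad [e_i,y]=e_i\ (2\le i\le n-1),\qquad [e_n,x]=2e_n,$$ and, if moreover $n$ is odd, let $R(g^{1}_{(n,1)},2)$ be the complex Lie algebra with basis $e_1,\dots,e_n,x,y$ and products $$[e_1,e_i]=e_{i+1}\ (2\le i\le n-2),\qquad [e_i,e_{n-i}]=(-1)^i e_n\ \left(2\le i\le \tfrac{n-1}{2}\right),$$ $$[e_1,x]=e_1,\qquad [e_i,x]=(i-2)e_i,\quad [e_i,y]=e_i\ (2\le i\le n-1),\qquad [e_n,x]=(n-4)e_n,\qquad [e_n,y]=2e_n.$$ In both cases the products in the opposite order are determined by antisymmetry and all products of basis elements not listed are zero. (These are solvable Lie algebras whose nilradical is spanned by $e_1,\dots,e_n$, with two-dimensional complement spanned by $x,y$.) For a Lie algebra $R$ let $H^2(R,R)$ be the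 second Chevalley--Eilenberg cohomology of $R$ with coefficients in the adjoint module: alternating bilinear maps $\varphi:R\times R\to R$ with $$[u,\varphi(v,w)]-[v,\varphi(u,w)]+[w,\varphi(u,v)]-\varphi([u,v],w)+\varphi([u,w],v)-\varphi([v,w],u)=0,$$ modulo the maps $(u,v)\mapsto [u,f(v)]-[v,f(u)]-f([u,v])$ with $f:R\to R$ linear. **Theorem.** $H^2\big(R(g^{1}_{(n,1)},2),R(g^{1}_{(n,1)},2)\big)=\{0\}$ for every odd $n\ge5$, and $H^2\big(R(g^{2}_{(n,1)},2),R(g^{2}_{(n,1)},2)\big)=\{0\}$ for every $n\ge5$. -/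

import Mathlib

set_option maxSynthPendingDepth 3

open Module

/-- The bilinear product on `ℂ^ι` given by a table of multiplication on the standard basis `b`.
Here `listed i j` is the product `[b i, b j]`
as far as it is listed in the table of a Lie algebra (each unordered pair is listed at most once);
the products in the opposite order are the negatives, all other products are zero. -/
noncomputable def tableMul {ι : Type} [Fintype ι] [DecidableEq ι] (listed : ι → ι → (ι → ℂ)) :
    (ι → ℂ) →ₗ[ℂ] (ι → ℂ) →ₗ[ℂ] (ι → ℂ) :=
  (Pi.basisFun ℂ ι).constr ℂ fun i =>
    (Pi.basisFun ℂ ι).constr ℂ fun j => listed i j - listed j i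

theorem tableMul_basis {ι : Type} [Fintype ι] [DecidableEq ι] (listed : ι → ι → (ι → ℂ))
    (i j : ι) :
    tableMul listed (Pi.basisFun ℂ ι i) (Pi.basisFun ℂ ι j) = listed i j - listed j i := by
  unfold tableMul
  rw [Basis.constr_basis, Basis.constr_basis]

theorem tableMul_skew {ι : Type} [Fintype ι] [DecidableEq ι] (listed : ι → ι → (ι → ℂ))
    (u v : ι → ℂ) : tableMul listed u v = - tableMul listed v u := by
  have h : tableMul listed = -(tableMul listed).flip := by
    refine (Pi.basisFun ℂ ι).ext fun i => (Pi.basisFun ℂ ι).ext fun j => ?_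
    rw [LinearMap.neg_apply, LinearMap.neg_apply, LinearMap.flip_apply, tableMul_basis,
      tableMul_basis, neg_sub]
  have h2 := congrArg (fun f => f u v) h
  simpa using h2

/-- A table of multiplication whose products satisfy the Jacobi identity on basis elements. -/
structure LieTable (ι : Type) [Fintype ι] [DecidableEq ι] where
  listed : ι → ι → (ι → ℂ)
  jacobi : ∀ i j k : ι,
    tableMul listed (listed i j - listed j i) (Pi.basisFun ℂ ι k) +
    tableMul listed (listed j k - listed k j) (Pi.basisFun ℂ ι i) +
    tableMul listed (listed k i - listed i k) (Pi.basisFun ℂ ι j) = 0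

theorem LieTable.jacobi' {ι : Type} [Fintype ι] [DecidableEq ι] (T : LieTable ι)
    (u v w : ι → ℂ) :
    tableMul T.listed (tableMul T.listed u v) w + tableMul T.listed (tableMul T.listed v w) u +
      tableMul T.listed (tableMul T.listed w u) v = 0 := by
  set M := tableMul T.listed with hM
  induction (Pi.basisFun ℂ ι).mem_span u using Submodule.span_induction with
  | mem _ hu =>
    obtain ⟨i, rfl⟩ := hu
    induction (Pi.basisFun ℂ ι).mem_span v using Submodule.span_induction with
    | mem _ hv =>
      obtain ⟨j, rfl⟩ := hv
      induction (Pi.basisFun ℂ ι).mem_span w using Submodule.span_induction with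
      | mem _ hw =>
        obtain ⟨k, rfl⟩ := hw
        rw [hM, tableMul_basis, tableMul_basis, tableMul_basis]
        exact T.jacobi i j k
      | zero => simp
      | add a b _ _ ha hb =>
        have := congrArg₂ (· + ·) ha hb
        simp only [map_add, LinearMap.add_apply, add_zero] at this ⊢
        rw [← this]; abel
      | smul c a _ ha =>
        have := congrArg (c • ·) ha
        simpa [smul_add] using this
    | zero => simp
    | add a b _ _ ha hb =>
      have := congrArg₂ (· + ·) ha hb
      simp only [map_add, LinearMap.add_apply, add_zero] at this ⊢
      rw [← this]; abel
    | smul c a _ ha =>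
      have := congrArg (c • ·) ha
      simpa [smul_add] using this
  | zero => simp
  | add a b _ _ ha hb =>
    have := congrArg₂ (· + ·) ha hb
    simp only [map_add, LinearMap.add_apply, add_zero] at this ⊢
    rw [← this]; abel
  | smul c a _ ha =>
    have := congrArg (c • ·) ha
    simpa [smul_add] using this

/-- The complex Lie algebra on `ℂ^ι` given by a table of multiplication. -/
def LieTable.Alg {ι : Type} [Fintype ι] [DecidableEq ι] (_ : LieTable ι) : Type := ι → ℂ

noncomputable section

instance {ι : Type} [Fintype ι] [DecidableEq ι] (T : LieTable ι) : AddCommGroup T.Alg :=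
  inferInstanceAs (AddCommGroup (ι → ℂ))

instance {ι : Type} [Fintype ι] [DecidableEq ι] (T : LieTable ι) : Module ℂ T.Alg :=
  inferInstanceAs (Module ℂ (ι → ℂ))

/-- The standard basis of the algebra. -/
def LieTable.basis {ι : Type} [Fintype ι] [DecidableEq ι] (T : LieTable ι) :
    Basis ι ℂ T.Alg :=
  Pi.basisFun ℂ ι

/-- The product of the algebra. -/
def LieTable.mul {ι : Type} [Fintype ι] [DecidableEq ι] (T : LieTable ι) :
    T.Alg →ₗ[ℂ] T.Alg →ₗ[ℂ] T.Alg :=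
  tableMul T.listed

theorem LieTable.mul_skew {ι : Type} [Fintype ι] [DecidableEq ι] (T : LieTable ι)
    (u v : T.Alg) : T.mul u v = - T.mul v u :=
  tableMul_skew T.listed u v

theorem LieTable.mul_jacobi {ι : Type} [Fintype ι] [DecidableEq ι] (T : LieTable ι)
    (u v w : T.Alg) :
    T.mul (T.mul u v) w + T.mul (T.mul v w) u + T.mul (T.mul w u) v = 0 :=
  T.jacobi' u v w

instance {ι : Type} [Fintype ι] [DecidableEq ι] (T : LieTable ι) : LieRing T.Alg where
  bracket u v := T.mul u v
  add_lie u v w := by change T.mul (u + v) w = T.mul u w + T.mul v w; simp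
  lie_add u v w := by change T.mul u (v + w) = T.mul u v + T.mul u w; simp
  lie_self u := by
    change T.mul u u = 0
    have h := T.mul_skew u u
    have h2 : (2 : ℂ) • T.mul u u = 0 := by
      rw [two_smul]; nth_rewrite 1 [h]; exact neg_add_cancel _
    exact (smul_eq_zero.mp h2).resolve_left two_ne_zero
  leibniz_lie u v w := by
    change T.mul u (T.mul v w) = T.mul (T.mul u v) w + T.mul v (T.mul u w)
    have h := T.mul_jacobi u v w
    rw [T.mul_skew (T.mul v w) u, T.mul_skew (T.mul w u) v, T.mul_skew w u, map_neg,
      neg_neg] at h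
    rw [eq_comm, ← sub_eq_zero, ← h]; abel

instance {ι : Type} [Fintype ι] [DecidableEq ι] (T : LieTable ι) : LieAlgebra ℂ T.Alg where
  lie_smul c u v := by change T.mul u (c • v) = c • T.mul u v; simp

theorem LieTable.lie_basis {ι : Type} [Fintype ι] [DecidableEq ι] (T : LieTable ι) (i j : ι) :
    ⁅T.basis i, T.basis j⁆ = (T.listed i j - T.listed j i : ι → ℂ) :=
  tableMul_basis T.listed i j

/-- The second Chevalley–Eilenberg cohomology of the Lie algebra `L` with coefficients in the
adjoint module `L`: alternating 2-cocycles modulo coboundaries of linear maps `L → L`. -/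
abbrev AdjointH2 (K L : Type) [CommRing K] [LieRing L] [LieAlgebra K L] : Type :=
  LieModule.Cohomology.twoCocycle K L L ⧸
    (LinearMap.range (LieModule.Cohomology.d₁₂ K L L)).submoduleOf
      (LieModule.Cohomology.twoCocycle K L L)

/-- Labels of the basis `e_1, …, e_n, x, y`. Here `inl i` is the label of `e_{i+1}`, while
`inr 0` and `inr 1` are the labels of `x` and `y`. -/
abbrev Lab (n : ℕ) : Type := Fin n ⊕ Fin 2

/-- The basis vector `e_k` for `1 ≤ k ≤ n` (and `0` for other `k`). -/
def eVec (n k : ℕ) : Lab n → ℂ :=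
  Sum.elim (fun i => if (i : ℕ) + 1 = k then 1 else 0) (fun _ => 0)

/-- Products `[e_a, e_b]` listed in the table of the nilradical `g¹_{(n,1)}`:
`[e_1, e_i] = e_{i+1}` for `2 ≤ i ≤ n - 2` and
`[e_i, e_{n-i}] = (-1)^i e_n` for `2 ≤ i ≤ (n - 1) / 2`. -/
def nil1 (n a b : ℕ) : Lab n → ℂ :=
  if a = 1 ∧ 2 ≤ b ∧ b + 2 ≤ n then eVec n (b + 1)
  else if 2 ≤ a ∧ 2 * a + 1 ≤ n ∧ a + b = n then (-1 : ℂ) ^ a • eVec n n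
  else 0

/-- Products `[e_a, e_b]` listed in the table of the nilradical `g²_{(n,1)}`:
`[e_1, e_i] = e_{i+1}` for `2 ≤ i ≤ n - 2` and `[e_i, e_n] = e_{i+2}` for `2 ≤ i ≤ n - 3`. -/
def nil2 (n a b : ℕ) : Lab n → ℂ :=
  if a = 1 ∧ 2 ≤ b ∧ b + 2 ≤ n then eVec n (b + 1)
  else if 2 ≤ a ∧ a + 3 ≤ n ∧ b = n then eVec n (a + 2)
  else 0

/-- `[e_k, x] = wtX n k p • e_k`, where `p` is the value for `k = n`. -/
def wtX (n k : ℕ) (p : ℂ) : ℂ :=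
  if k = 1 then 1 else if k = n then p else (k : ℂ) - 2

/-- `[e_k, y] = wtY n k q • e_k`, where `q` is the value for `k = n`. -/
def wtY (n k : ℕ) (q : ℂ) : ℂ :=
  if k = 1 then 0 else if k = n then q else 1

/-- Table on `e_1, …, e_n, x, y` with the products `nil` on `e_1, …, e_n` and with
`[e_k, x]`, `[e_k, y]` multiples of `e_k`. -/
def listedTable (n : ℕ) (nil : ℕ → ℕ → (Lab n → ℂ)) (p q : ℂ) : Lab n → Lab n → (Lab n → ℂ)
  | .inl i, .inl j => nil (i + 1) (j + 1)
  | .inl i, .inr s =>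
      (if s = 0 then wtX n (i + 1) p else wtY n (i + 1) q) • eVec n (i + 1)
  | .inr _, _ => 0

/-- The listed products of `R(g¹_{(n,1)}, 2)`. -/
def listed1 (n : ℕ) : Lab n → Lab n → (Lab n → ℂ) :=
  listedTable n (nil1 n) ((n : ℂ) - 4) 2

/-- The listed products of `R(g²_{(n,1)}, 2)`. -/
def listed2 (n : ℕ) : Lab n → Lab n → (Lab n → ℂ) :=
  listedTable n (nil2 n) 2 0

theorem eVec_eq (n : ℕ) (i : Fin n) : eVec n (i + 1) = Pi.basisFun ℂ (Lab n) (.inl i) := by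
  ext l
  rcases l with l | l
  · simp [eVec, Pi.single_apply, Fin.ext_iff]
  · simp [eVec]


/-- The basis vectors `x` (for `s = 0`) and `y` (for `s = 1`). -/
def qVec (n : ℕ) (s : Fin 2) : Lab n → ℂ := Pi.basisFun ℂ (Lab n) (.inr s)

/-- The weight of `e_k` for `x` (for `s = 0`) and `y` (for `s = 1`). -/
def wtQ (n : ℕ) (p q : ℂ) (s : Fin 2) (k : ℕ) : ℂ :=
  if s = 0 then wtX n k p else wtY n k q

theorem mul_ee (n : ℕ) (nil : ℕ → ℕ → (Lab n → ℂ)) (p q : ℂ) (a b : ℕ)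
    (ha : 1 ≤ a ∧ a ≤ n) (hb : 1 ≤ b ∧ b ≤ n) :
    tableMul (listedTable n nil p q) (eVec n a) (eVec n b) = nil a b - nil b a := by
  obtain ⟨a, rfl⟩ : ∃ c, a = c + 1 := ⟨a - 1, by omega⟩
  obtain ⟨b, rfl⟩ : ∃ c, b = c + 1 := ⟨b - 1, by omega⟩
  have h1 := eVec_eq n ⟨a, by omega⟩
  have h2 := eVec_eq n ⟨b, by omega⟩
  simp only at h1 h2
  rw [h1, h2, tableMul_basis]
  rfl

theorem mul_eq (n : ℕ) (nil : ℕ → ℕ → (Lab n → ℂ)) (p q : ℂ) (a : ℕ) (s : Fin 2)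
    (ha : 1 ≤ a ∧ a ≤ n) :
    tableMul (listedTable n nil p q) (eVec n a) (qVec n s) = wtQ n p q s a • eVec n a := by
  obtain ⟨a, rfl⟩ : ∃ c, a = c + 1 := ⟨a - 1, by omega⟩
  have h1 := eVec_eq n ⟨a, by omega⟩
  simp only at h1
  rw [h1, qVec, tableMul_basis, ← h1]
  simp [listedTable, wtQ]

/-- The Jacobi identity for a table, from the identity on `e_1, …, e_n` and the additivity of
weights. -/
theorem jacobi_listedTable (n : ℕ) (nil : ℕ → ℕ → (Lab n → ℂ)) (p q : ℂ)
    (hw : ∀ a b s, (1 ≤ a ∧ a ≤ n) → (1 ≤ b ∧ b ≤ n) →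
      tableMul (listedTable n nil p q) (nil a b) (qVec n s) =
        (wtQ n p q s a + wtQ n p q s b) • nil a b)
    (hn : ∀ a b c, (1 ≤ a ∧ a ≤ n) → (1 ≤ b ∧ b ≤ n) → (1 ≤ c ∧ c ≤ n) →
      tableMul (listedTable n nil p q) (nil a b - nil b a) (eVec n c) +
      tableMul (listedTable n nil p q) (nil b c - nil c b) (eVec n a) +
      tableMul (listedTable n nil p q) (nil c a - nil a c) (eVec n b) = 0)
    (i j k : Lab n) :
    tableMul (listedTable n nil p q) (listedTable n nil p q i j - listedTable n nil p q j i)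
      (Pi.basisFun ℂ (Lab n) k) +
    tableMul (listedTable n nil p q) (listedTable n nil p q j k - listedTable n nil p q k j)
      (Pi.basisFun ℂ (Lab n) i) +
    tableMul (listedTable n nil p q) (listedTable n nil p q k i - listedTable n nil p q i k)
      (Pi.basisFun ℂ (Lab n) j) = 0 := by
  have r : ∀ i : Fin n, 1 ≤ (i : ℕ) + 1 ∧ (i : ℕ) + 1 ≤ n := fun i => ⟨by omega, i.2⟩
  have hq : ∀ s, Pi.basisFun ℂ (Lab n) (.inr s) = qVec n s := fun s => rfl
  have l1 : ∀ i j : Fin n, listedTable n nil p q (.inl i) (.inl j) = nil (i + 1) (j + 1) :=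
    fun i j => rfl
  have l2 : ∀ (i : Fin n) s, listedTable n nil p q (.inl i) (.inr s) =
    wtQ n p q s (i + 1) • eVec n (i + 1) := fun i s => rfl
  have l3 : ∀ s (j : Lab n), listedTable n nil p q (.inr s) j = 0 := fun s j => rfl
  rcases i with i | i <;> rcases j with j | j <;> rcases k with k | k <;>
    simp only [← eVec_eq, hq, l1, l2, l3, sub_zero, zero_sub, map_neg, map_smul, map_sub,
      LinearMap.sub_apply, LinearMap.neg_apply, LinearMap.smul_apply, map_zero,
      LinearMap.zero_apply, sub_self,
      mul_ee n nil p q _ _ (r _) (r _), mul_eq n nil p q _ _ (r _), hw _ _ _ (r _) (r _)]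
  · have := hn (i + 1) (j + 1) (k + 1) (r i) (r j) (r k)
    simpa only [map_sub, LinearMap.sub_apply] using this
  all_goals module

/-- The products of `g¹_{(n,1)}` on basis elements, in either order. -/
theorem nil1_sub (n a b : ℕ) (hodd : Odd n) : nil1 n a b - nil1 n b a =
    if a = 1 ∧ 2 ≤ b ∧ b + 2 ≤ n then eVec n (b + 1)
    else if b = 1 ∧ 2 ≤ a ∧ a + 2 ≤ n then -eVec n (a + 1)
    else if 2 ≤ a ∧ 2 ≤ b ∧ a + b = n then (-1 : ℂ) ^ a • eVec n n else 0 := by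
  obtain ⟨m, hm⟩ := hodd
  unfold nil1
  split_ifs with h1 h2 h3 h4 h5 h6 h7 h8 h9 h10 h11 <;> first | (exfalso; omega) | simp
  rw [← neg_smul]
  congr 1
  have : (-1 : ℂ) ^ (a + b) = -1 := by
    rw [show a + b = 2 * m + 1 by omega, pow_succ, pow_mul]; simp
  rw [pow_add] at this
  have h : (-1 : ℂ) ^ b * (-1) ^ b = 1 := by rw [← mul_pow]; simp
  linear_combination (-1 : ℂ) ^ a * h - (-1) ^ b * this

theorem mul_nil1 (n : ℕ) (hn : 5 ≤ n) (hodd : Odd n) (p q : ℂ) (a b c : ℕ)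
    (hc : 1 ≤ c ∧ c ≤ n) :
    tableMul (listedTable n (nil1 n) p q) (nil1 n a b - nil1 n b a) (eVec n c) =
    if a = 1 ∧ 2 ≤ b ∧ b + 2 ≤ n then
      (if c = 1 ∧ b + 3 ≤ n then -eVec n (b + 2)
       else if 2 ≤ c ∧ b + 1 + c = n then -((-1 : ℂ) ^ b • eVec n n) else 0)
    else if b = 1 ∧ 2 ≤ a ∧ a + 2 ≤ n then
      -(if c = 1 ∧ a + 3 ≤ n then -eVec n (a + 2)
       else if 2 ≤ c ∧ a + 1 + c = n then -((-1 : ℂ) ^ a • eVec n n) else 0)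
    else 0 := by
  rw [nil1_sub n a b hodd]
  split_ifs <;> try simp only [map_neg, map_smul, LinearMap.neg_apply, LinearMap.smul_apply, map_zero,
    LinearMap.zero_apply]
  all_goals
    rw [mul_ee n (nil1 n) p q _ _ (by omega) hc, nil1_sub n _ _ hodd]
    split_ifs <;> first | (exfalso; omega) | simp [pow_succ]

set_option maxHeartbeats 1000000 in
theorem jacobi1 (n : ℕ) (hn : 5 ≤ n) (hodd : Odd n) (i j k : Lab n) :
    tableMul (listed1 n) (listed1 n i j - listed1 n j i) (Pi.basisFun ℂ (Lab n) k) +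
    tableMul (listed1 n) (listed1 n j k - listed1 n k j) (Pi.basisFun ℂ (Lab n) i) +
    tableMul (listed1 n) (listed1 n k i - listed1 n i k) (Pi.basisFun ℂ (Lab n) j) = 0 := by
  refine jacobi_listedTable n (nil1 n) _ _ ?_ ?_ i j k
  · intro a b s ha hb
    unfold nil1
    split_ifs with h1 h2
    · obtain ⟨rfl, h1, h2⟩ := h1
      rw [mul_eq _ _ _ _ _ _ (by omega)]
      congr 1
      have : ¬ n = b + 1 := by omega
      fin_cases s <;> simp [wtQ, wtX, wtY, show ¬ b = 0 by omega, show ¬ b = n by omega,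
        show ¬ b + 1 = n by omega, show ¬ b = 1 by omega]
      ring
    · obtain ⟨h1, h2, h3⟩ := h2
      rw [map_smul, LinearMap.smul_apply, mul_eq _ _ _ _ _ _ (by omega), smul_comm]
      congr 1
      fin_cases s <;> simp [wtQ, wtX, wtY, show ¬ a = 1 by omega, show ¬ a = n by omega,
        show ¬ b = n by omega, show ¬ b = 1 by omega, show ¬ n = 1 by omega]
      · rw [← h3]; push_cast; ring
      · norm_num
    · simp
  · intro a b c ha hb hc
    rw [mul_nil1 n hn hodd _ _ a b c hc, mul_nil1 n hn hodd _ _ b c a ha,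
      mul_nil1 n hn hodd _ _ c a b hb]
    have key : ∀ i j : ℕ, i + 1 + j = n → (-1 : ℂ) ^ i = (-1) ^ j := by
      intro i j h
      obtain ⟨m, hm⟩ := hodd
      rcases Nat.even_or_odd i with hi | hi
      · have hj : Even j := by grind
        rw [hi.neg_one_pow, hj.neg_one_pow]
      · have hj : Odd j := by grind
        rw [hi.neg_one_pow, hj.neg_one_pow]
    have cls : ∀ k : ℕ, 1 ≤ k → k = 1 ∨ 2 ≤ k := by omega
    rcases cls a ha.1 with h | h <;> rcases cls b hb.1 with h' | h' <;>
    rcases cls c hc.1 with h'' | h'' <;>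
    simp (disch := omega) only [if_neg, add_zero, zero_add, neg_zero] <;>
    split_ifs <;> first
      | (exfalso; omega)
      | (subst_vars; simp; done)
      | (rw [key a b (by omega)]; simp)
      | (rw [key b c (by omega)]; simp)
      | (rw [key c a (by omega)]; simp)

/-- The products of `g²_{(n,1)}` on basis elements, in either order. -/
theorem nil2_sub (n a b : ℕ) (hn : 5 ≤ n) : nil2 n a b - nil2 n b a =
    if a = 1 ∧ 2 ≤ b ∧ b + 2 ≤ n then eVec n (b + 1)
    else if b = 1 ∧ 2 ≤ a ∧ a + 2 ≤ n then -eVec n (a + 1)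
    else if 2 ≤ a ∧ a + 3 ≤ n ∧ b = n then eVec n (a + 2)
    else if 2 ≤ b ∧ b + 3 ≤ n ∧ a = n then -eVec n (b + 2) else 0 := by
  unfold nil2
  split_ifs <;> first | (exfalso; omega) | simp

theorem mul_nil2_aux (n : ℕ) (hn : 5 ≤ n) (p q : ℂ) (k c : ℕ)
    (hk : 3 ≤ k ∧ k + 1 ≤ n) (hc : 1 ≤ c ∧ c ≤ n) :
    tableMul (listedTable n (nil2 n) p q) (eVec n k) (eVec n c) =
    if c = 1 ∧ k + 2 ≤ n then -eVec n (k + 1)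
    else if c = n ∧ k + 3 ≤ n then eVec n (k + 2) else 0 := by
  rw [mul_ee n (nil2 n) p q _ _ (by omega) hc, nil2_sub n _ _ hn]
  split_ifs <;> first | (exfalso; omega) | rfl

theorem mul_nil2 (n : ℕ) (hn : 5 ≤ n) (p q : ℂ) (a b c : ℕ)
    (hc : 1 ≤ c ∧ c ≤ n) :
    tableMul (listedTable n (nil2 n) p q) (nil2 n a b - nil2 n b a) (eVec n c) =
    if a = 1 ∧ 2 ≤ b ∧ b + 2 ≤ n then
      (if c = 1 ∧ b + 3 ≤ n then -eVec n (b + 2)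
       else if c = n ∧ b + 4 ≤ n then eVec n (b + 3) else 0)
    else if b = 1 ∧ 2 ≤ a ∧ a + 2 ≤ n then
      -(if c = 1 ∧ a + 3 ≤ n then -eVec n (a + 2)
       else if c = n ∧ a + 4 ≤ n then eVec n (a + 3) else 0)
    else if 2 ≤ a ∧ a + 3 ≤ n ∧ b = n then
      (if c = 1 ∧ a + 4 ≤ n then -eVec n (a + 3)
       else if c = n ∧ a + 5 ≤ n then eVec n (a + 4) else 0)
    else if 2 ≤ b ∧ b + 3 ≤ n ∧ a = n then
      -(if c = 1 ∧ b + 4 ≤ n then -eVec n (b + 3)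
       else if c = n ∧ b + 5 ≤ n then eVec n (b + 4) else 0)
    else 0 := by
  rw [nil2_sub n a b hn]
  by_cases h1 : a = 1 ∧ 2 ≤ b ∧ b + 2 ≤ n
  · rw [if_pos h1, if_pos h1, mul_nil2_aux n hn p q _ _ (by omega) hc]
  rw [if_neg h1, if_neg h1]
  by_cases h2 : b = 1 ∧ 2 ≤ a ∧ a + 2 ≤ n
  · rw [if_pos h2, if_pos h2, map_neg, LinearMap.neg_apply,
      mul_nil2_aux n hn p q _ _ (by omega) hc]
  rw [if_neg h2, if_neg h2]
  by_cases h3 : 2 ≤ a ∧ a + 3 ≤ n ∧ b = n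
  · rw [if_pos h3, if_pos h3, mul_nil2_aux n hn p q _ _ (by omega) hc]
  rw [if_neg h3, if_neg h3]
  by_cases h4 : 2 ≤ b ∧ b + 3 ≤ n ∧ a = n
  · rw [if_pos h4, if_pos h4, map_neg, LinearMap.neg_apply,
      mul_nil2_aux n hn p q _ _ (by omega) hc]
  rw [if_neg h4, if_neg h4, map_zero, LinearMap.zero_apply]

set_option maxHeartbeats 1000000 in
theorem jacobi2 (n : ℕ) (hn : 5 ≤ n) (i j k : Lab n) :
    tableMul (listed2 n) (listed2 n i j - listed2 n j i) (Pi.basisFun ℂ (Lab n) k) +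
    tableMul (listed2 n) (listed2 n j k - listed2 n k j) (Pi.basisFun ℂ (Lab n) i) +
    tableMul (listed2 n) (listed2 n k i - listed2 n i k) (Pi.basisFun ℂ (Lab n) j) = 0 := by
  refine jacobi_listedTable n (nil2 n) _ _ ?_ ?_ i j k
  · intro a b s ha hb
    unfold nil2
    split_ifs with h1 h2
    · obtain ⟨rfl, h1, h2⟩ := h1
      rw [mul_eq _ _ _ _ _ _ (by omega)]
      congr 1
      fin_cases s <;> simp [wtQ, wtX, wtY, show ¬ b = 0 by omega, show ¬ b = n by omega,
        show ¬ b + 1 = n by omega, show ¬ b = 1 by omega]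
      ring
    · obtain ⟨h1, h2, rfl⟩ := h2
      rw [mul_eq _ _ _ _ _ _ (by omega)]
      congr 1
      fin_cases s <;> simp [wtQ, wtX, wtY, show ¬ a = 1 by omega, show ¬ a = b by omega,
        show ¬ a + 2 = b by omega, show ¬ b = 1 by omega]
    · simp
  · intro a b c ha hb hc
    rw [mul_nil2 n hn _ _ a b c hc, mul_nil2 n hn _ _ b c a ha, mul_nil2 n hn _ _ c a b hb]
    have cls : ∀ k : ℕ, (1 ≤ k ∧ k ≤ n) → k = 1 ∨ k = n ∨ (2 ≤ k ∧ k + 1 ≤ n) := by omega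
    rcases cls a ha with h | h | h <;> rcases cls b hb with h' | h' | h' <;>
    rcases cls c hc with h'' | h'' | h'' <;>
    simp (disch := omega) only [if_neg, add_zero, zero_add, neg_zero] <;>
    split_ifs <;> first
      | (exfalso; omega)
      | (subst_vars; simp)

/-- The complex Lie algebra `R(g¹_{(n,1)}, 2)`. -/
def R1 (n : ℕ) (hn : 5 ≤ n) (hodd : Odd n) : LieTable (Lab n) where
  listed := listed1 n
  jacobi := jacobi1 n hn hodd

/-- The complex Lie algebra `R(g²_{(n,1)}, 2)`. -/
def R2 (n : ℕ) (hn : 5 ≤ n) : LieTable (Lab n) where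
  listed := listed2 n
  jacobi := jacobi2 n hn

end

/-! The span of `x`, `y` acts diagonally on `e_1, …, e_n`, and this torus forces the vanishing. An
element `h` of a Lie algebra acts trivially on cohomology: by Cartan's formula the Lie derivative of
a cocycle along `h` is the coboundary of its contraction with `h`. If `ad h` is diagonal, every
cocycle is therefore cohomologous to one that preserves weights (`exists_weight_preserving`). Since
the weights for `x` and `y` are integers, the single element `-(x + i y)` separates pairs of
weights.

The weights of the `e_k` are distinct and nonzero, so little of a weight-preserving cocycle `φ`
survives. The value `φ(x, y)` has weight zero and commutes with all `e_k`, hence vanishes. The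
values `φ(e_k, x)` and `φ(e_k, y)` are multiples of `e_k`, and their coefficients define diagonal
derivations of the nilradical; these all come from the torus, so a map sending `x`, `y` into the
torus accounts for them (`subsingleton_of_nilradical`).

On the nilradical, `φ` only rescales the nonzero brackets. A diagonal map with coefficients `μ` is
adjusted along the chain `e_2, e_3, …` to match `φ(e_1, e_i)`, and then at `e_n` to match one
further bracket. The cocycle identity gives a recursion that makes all remaining brackets match
(`R2_coboundary`, `R1_coboundary`). -/

namespace LieModule.Cohomology

/-! ### Lie derivatives and the reduction to weight-preserving cocycles -/

theorem d₁₂_mem_twoCocycle {K L : Type} [CommRing K] [LieRing L] [LieAlgebra K L]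
    (f : L →ₗ[K] L) : d₁₂ K L L f ∈ twoCocycle K L L := by
  rw [mem_twoCocycle_iff, ← LinearMap.comp_apply, d₂₃_comp_d₁₂, LinearMap.zero_apply]

theorem cocycle_apply {K L : Type} [CommRing K] [LieRing L] [LieAlgebra K L]
    {φ : twoCochain K L L} (hφ : φ ∈ twoCocycle K L L) (u v w : L) :
    ⁅u, φ v w⁆ - ⁅v, φ u w⁆ + ⁅w, φ u v⁆ - φ ⁅u, v⁆ w + φ ⁅u, w⁆ v - φ ⁅v, w⁆ u = 0 := by
  rw [mem_twoCocycle_iff] at hφ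
  have := congrArg (fun b => b u v w) hφ
  simpa using this

@[simp]
theorem sub_apply_apply {K L : Type} [CommRing K] [LieRing L] [LieAlgebra K L]
    (a b : twoCochain K L L) (u v : L) : (a - b) u v = a u v - b u v := rfl

/-- The adjoint second cohomology vanishes once every cocycle is a coboundary. -/
theorem subsingleton_adjointH2 {K L : Type} [CommRing K] [LieRing L] [LieAlgebra K L]
    (h : ∀ φ ∈ twoCocycle K L L, ∃ f : L →ₗ[K] L, φ = d₁₂ K L L f) :
    Subsingleton (AdjointH2 K L) := by
  rw [Submodule.Quotient.subsingleton_iff, eq_top_iff]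
  rintro ⟨φ, hφ⟩ -
  obtain ⟨f, rfl⟩ := h φ hφ
  exact ⟨f, rfl⟩

/-- The Lie derivative along `h` of a linear endomorphism of `L`. -/
def lieDer {K L : Type} [CommRing K] [LieRing L] [LieAlgebra K L] (h : L) (f : L →ₗ[K] L) :
    L →ₗ[K] L :=
  LieAlgebra.ad K L h ∘ₗ f - f ∘ₗ LieAlgebra.ad K L h

/-- The coboundary commutes with the Lie derivative. -/
theorem d₁₂_lieDer {K L : Type} [CommRing K] [LieRing L] [LieAlgebra K L] (h : L)
    (f : L →ₗ[K] L) (u v : L) :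
    d₁₂ K L L (lieDer h f) u v =
      ⁅h, d₁₂ K L L f u v⁆ - d₁₂ K L L f ⁅h, u⁆ v - d₁₂ K L L f u ⁅h, v⁆ := by
  simp only [d₁₂_apply_apply, lieDer, LinearMap.sub_apply, LinearMap.comp_apply,
    LieAlgebra.ad_apply, lie_sub]
  rw [leibniz_lie h u v, leibniz_lie h u (f v), leibniz_lie h v (f u), map_add]
  abel

/-- Cartan's formula on a cocycle. -/
theorem d₁₂_contract {K L : Type} [CommRing K] [LieRing L] [LieAlgebra K L]
    {φ : twoCochain K L L} (hφ : φ ∈ twoCocycle K L L) (h u v : L) :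
    d₁₂ K L L (φ h) u v = ⁅h, φ u v⁆ - φ ⁅h, u⁆ v - φ u ⁅h, v⁆ := by
  have := cocycle_apply hφ h u v
  rw [← twoCochain_skew φ u ⁅h, v⁆, ← twoCochain_skew φ h ⁅u, v⁆] at this
  rw [d₁₂_apply_apply, ← sub_eq_zero, ← neg_eq_zero, ← this]
  abel

theorem repr_lie_of_diagonal {K L ι : Type} [Field K] [LieRing L] [LieAlgebra K L]
    (b : Basis ι K L) {h : L} {wt : ι → K} (hb : ∀ i, ⁅h, b i⁆ = wt i • b i) (v : L) (k : ι) :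
    b.repr ⁅h, v⁆ k = wt k * b.repr v k := by
  have : (Finsupp.lapply k ∘ₗ b.repr.toLinearMap) ∘ₗ LieAlgebra.ad K L h =
      wt k • (Finsupp.lapply k ∘ₗ b.repr.toLinearMap) := by
    refine b.ext fun i => ?_
    by_cases hik : i = k
    · subst hik; simp [hb]
    · simp [hb, hik]
  simpa using congrArg (fun g => g v) this

/-- If `h` acts diagonally, then every cocycle is cohomologous to one that preserves weights. -/
theorem exists_weight_preserving {K L ι : Type} [Field K] [LieRing L] [LieAlgebra K L]
    [Fintype ι] (b : Basis ι K L) {h : L} {wt : ι → K} (hb : ∀ i, ⁅h, b i⁆ = wt i • b i)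
    {φ : twoCochain K L L} (hφ : φ ∈ twoCocycle K L L) :
    ∃ f : L →ₗ[K] L, ∀ i j k, wt k ≠ wt i + wt j →
      b.repr ((φ - d₁₂ K L L f) (b i) (b j)) k = 0 := by
  -- The Lie derivative multiplies the `(k, i)` matrix entry by `wt k - wt i`; `f` inverts this on
  -- the contraction of `φ` with `h`. Entries of equal weight become zero, as `0⁻¹ = 0`.
  let f : L →ₗ[K] L := b.constr K fun i =>
    ∑ k, ((wt k - wt i)⁻¹ * b.repr (φ h (b i)) k) • b k
  refine ⟨f, fun i j k hk => ?_⟩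
  have hf : ∀ i k, b.repr (f (b i)) k = (wt k - wt i)⁻¹ * b.repr (φ h (b i)) k := by
    intro i k
    rw [show f (b i) = _ from b.constr_basis K _ i, b.repr_sum_self]
  have hlie : ∀ (g : L →ₗ[K] L) i k,
      b.repr (lieDer h g (b i)) k = (wt k - wt i) * b.repr (g (b i)) k := by
    intro g i k
    simp only [lieDer, LinearMap.sub_apply, LinearMap.comp_apply, LieAlgebra.ad_apply, map_sub,
      Finsupp.sub_apply, repr_lie_of_diagonal b hb, hb, map_smul, Finsupp.smul_apply, smul_eq_mul]
    ring
  -- Only entries with `wt k = wt i` remain in the difference, and the Lie derivative kills them.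
  have key : lieDer h (φ h - lieDer h f) = 0 := by
    refine b.ext fun i => b.repr.injective <| Finsupp.ext fun k => ?_
    rw [hlie, LinearMap.sub_apply, map_sub, Finsupp.sub_apply, hlie, hf, LinearMap.zero_apply,
      map_zero, Finsupp.zero_apply]
    by_cases h0 : wt k - wt i = 0
    · simp [h0]
    · field_simp; ring
  have step : ∀ ψ : twoCochain K L L, ∀ i j k, b.repr (⁅h, ψ (b i) (b j)⁆ - ψ ⁅h, b i⁆ (b j) -
      ψ (b i) ⁅h, b j⁆) k = (wt k - wt i - wt j) * b.repr (ψ (b i) (b j)) k := by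
    intro ψ i j k
    simp only [map_sub, Finsupp.sub_apply, repr_lie_of_diagonal b hb, hb, map_smul,
      LinearMap.smul_apply, Finsupp.smul_apply, smul_eq_mul]
    ring
  -- Applying the Lie derivative twice to `φ - d₁₂ f` gives zero. On the component at `i, j, k` it
  -- multiplies by `wt k - wt i - wt j`, so this nonzero factor is cancelled twice.
  have h1 := step (d₁₂ K L L (φ h - lieDer h f)) i j k
  rw [← d₁₂_lieDer, key] at h1
  have h2 := step φ i j k
  rw [← d₁₂_contract hφ] at h2
  have h3 := step (d₁₂ K L L f) i j k
  rw [← d₁₂_lieDer] at h3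
  rw [map_sub, sub_apply_apply, map_sub, Finsupp.sub_apply, h2, h3] at h1
  have h4 : wt k - wt i - wt j ≠ 0 := fun h => hk (by linear_combination h)
  rw [map_zero] at h1
  have h5 : (0 : twoCochain K L L) (b i) (b j) = 0 := rfl
  rw [h5, map_zero, Finsupp.zero_apply] at h1
  rw [sub_apply_apply, map_sub, Finsupp.sub_apply]
  have h6 := mul_left_cancel₀ h4 ((mul_zero _).trans h1)
  refine mul_left_cancel₀ h4 ?_
  rw [mul_zero]; linear_combination -h6

/-- The adjoint second cohomology vanishes if the weight-preserving cocycles are coboundaries. -/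
theorem subsingleton_adjointH2_of_diagonal {K L ι : Type} [Field K] [LieRing L]
    [LieAlgebra K L] [Fintype ι] (b : Basis ι K L) {h : L} {wt : ι → K}
    (hb : ∀ i, ⁅h, b i⁆ = wt i • b i)
    (hcob : ∀ φ ∈ twoCocycle K L L,
      (∀ i j k, wt k ≠ wt i + wt j → b.repr (φ (b i) (b j)) k = 0) →
      ∃ f : L →ₗ[K] L, ∀ i j, φ (b i) (b j) = d₁₂ K L L f (b i) (b j)) :
    Subsingleton (AdjointH2 K L) := by
  refine subsingleton_adjointH2 fun φ hφ => ?_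
  obtain ⟨f, hf⟩ := exists_weight_preserving b hb hφ
  obtain ⟨g, hg⟩ := hcob _ (sub_mem hφ (d₁₂_mem_twoCocycle f)) hf
  refine ⟨f + g, Subtype.ext <| b.ext fun i => b.ext fun j => ?_⟩
  have := hg i j
  rw [sub_apply_apply, sub_eq_iff_eq_add'] at this
  rw [map_add]
  exact this

end LieModule.Cohomology

/-! ### Weights for `x`, `y` and weight-preserving cochains -/

open LieModule.Cohomology

/-- The basis vector `e_k` of the algebra. -/
noncomputable def LieTable.E {n : ℕ} (T : LieTable (Lab n)) (k : ℕ) : T.Alg := eVec n k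

/-- The basis vectors `x`, `y` of the algebra. -/
noncomputable def LieTable.Q {n : ℕ} (T : LieTable (Lab n)) (s : Fin 2) : T.Alg := qVec n s

/-- The integral weights of `e_k`. -/
def eWt (n : ℕ) (p q : ℤ) (s : Fin 2) (k : ℕ) : ℤ :=
  if s = 0 then (if k = 1 then 1 else if k = n then p else (k : ℤ) - 2)
  else (if k = 1 then 0 else if k = n then q else 1)

theorem wtQ_intCast (n : ℕ) (p q : ℤ) (s : Fin 2) (k : ℕ) :
    wtQ n p q s k = eWt n p q s k := by
  unfold wtQ wtX wtY eWt
  split_ifs <;> simp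

theorem eWt_zero (n : ℕ) (p q : ℤ) (k : ℕ) :
    eWt n p q 0 k = if k = 1 then 1 else if k = n then p else (k : ℤ) - 2 := rfl

theorem eWt_one (n : ℕ) (p q : ℤ) (k : ℕ) :
    eWt n p q 1 k = if k = 1 then 0 else if k = n then q else 1 := rfl

/-- The integral weights of the basis vectors. -/
def labWt (n : ℕ) (p q : ℤ) (s : Fin 2) : Lab n → ℤ :=
  Sum.elim (fun i => eWt n p q s (i + 1)) (fun _ => 0)

section

variable {n : ℕ} {T : LieTable (Lab n)} {nil : ℕ → ℕ → (Lab n → ℂ)} {p q : ℤ}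

theorem basis_inl (i : Fin n) : T.basis (.inl i) = T.E (i + 1) := (eVec_eq n i).symm

theorem basis_inr (s : Fin 2) : T.basis (.inr s) = T.Q s := rfl

theorem exists_basis_eq_E {k : ℕ} (hk : 1 ≤ k ∧ k ≤ n) :
    ∃ i : Fin n, (i : ℕ) + 1 = k ∧ T.basis (.inl i) = T.E k := by
  refine ⟨⟨k - 1, by omega⟩, by simp; omega, ?_⟩
  rw [basis_inl]; congr 1; simp; omega

theorem E_ne_zero {k : ℕ} (hk : 1 ≤ k ∧ k ≤ n) : T.E k ≠ 0 := by
  obtain ⟨i, -, hi⟩ := exists_basis_eq_E (T := T) hk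
  rw [← hi]
  exact T.basis.ne_zero _

theorem lie_E_E (hT : T.listed = listedTable n nil p q) {a b : ℕ}
    (ha : 1 ≤ a ∧ a ≤ n) (hb : 1 ≤ b ∧ b ≤ n) :
    ⁅T.E a, T.E b⁆ = (nil a b - nil b a : Lab n → ℂ) := by
  rw [← mul_ee n nil p q a b ha hb, ← hT]
  rfl

theorem lie_E_Q (hT : T.listed = listedTable n nil p q) {a : ℕ} (ha : 1 ≤ a ∧ a ≤ n)
    (s : Fin 2) : ⁅T.E a, T.Q s⁆ = (eWt n p q s a : ℂ) • T.E a := by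
  rw [← wtQ_intCast]
  refine Eq.trans ?_ (mul_eq n nil p q a s ha)
  rw [← hT]
  rfl

theorem lie_Q_Q (hT : T.listed = listedTable n nil p q) (s t : Fin 2) :
    ⁅T.Q s, T.Q t⁆ = 0 := by
  rw [← basis_inr, ← basis_inr, LieTable.lie_basis, hT]
  exact sub_self _

theorem lie_Q_basis (hT : T.listed = listedTable n nil p q) (s : Fin 2) (i : Lab n) :
    ⁅T.Q s, T.basis i⁆ = (-(labWt n p q s i : ℂ)) • T.basis i := by
  rcases i with i | t
  · rw [basis_inl, ← lie_skew, lie_E_Q hT ⟨by omega, i.2⟩, neg_smul]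
    rfl
  · rw [basis_inr, lie_Q_Q hT]
    simp [labWt]

/-- A 2-cochain that preserves weights. -/
def WeightPreserving (p q : ℤ) (φ : twoCochain ℂ T.Alg T.Alg) : Prop :=
  ∀ i j k, T.basis.repr (φ (T.basis i) (T.basis j)) k ≠ 0 →
    ∀ s, labWt n p q s k = labWt n p q s i + labWt n p q s j

theorem add_I_mul_inj {a b c d : ℤ} (h : (a : ℂ) + Complex.I * b = c + Complex.I * d) :
    a = c ∧ b = d := by
  have h1 := congrArg Complex.re h
  have h2 := congrArg Complex.im h
  simp at h1 h2
  exact ⟨h1, h2⟩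

/-- The adjoint second cohomology vanishes if the weight-preserving cocycles are coboundaries. -/
theorem subsingleton_of_weightPreserving (hT : T.listed = listedTable n nil p q)
    (hcob : ∀ φ ∈ twoCocycle ℂ T.Alg T.Alg, WeightPreserving p q φ →
      ∃ f : T.Alg →ₗ[ℂ] T.Alg, ∀ i j,
        φ (T.basis i) (T.basis j) = d₁₂ ℂ T.Alg T.Alg f (T.basis i) (T.basis j)) :
    Subsingleton (AdjointH2 ℂ T.Alg) := by
  -- Weights are defined by right brackets `[e_k, x]`, hence the minus sign. The factor `i` lets one
  -- complex eigenvalue record both integral weights.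
  refine subsingleton_adjointH2_of_diagonal T.basis (h := -(T.Q 0 + Complex.I • T.Q 1))
    (wt := fun l => (labWt n p q 0 l : ℂ) + Complex.I * labWt n p q 1 l) (fun i => ?_)
    fun φ hφ hw => hcob φ hφ fun i j k hk s => ?_
  · simp only [neg_lie, add_lie, smul_lie, lie_Q_basis hT]
    module
  · have h := not_imp_comm.1 (hw i j k) hk
    obtain ⟨h0, h1⟩ := add_I_mul_inj (a := labWt n p q 0 k) (b := labWt n p q 1 k)
      (c := labWt n p q 0 i + labWt n p q 0 j) (d := labWt n p q 1 i + labWt n p q 1 j)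
      (by push_cast; rw [h]; ring)
    fin_cases s
    · exact h0
    · exact h1

/-- Every component of the value has the same weight, the sum of the weights of the arguments, and
`ad` of `x` or `y` acts by minus that weight. -/
theorem lie_Q_cochain (hT : T.listed = listedTable n nil p q)
    {φ : twoCochain ℂ T.Alg T.Alg} (hw : WeightPreserving p q φ) (s : Fin 2) (i j : Lab n) :
    ⁅T.Q s, φ (T.basis i) (T.basis j)⁆ =
      (-((labWt n p q s i : ℂ) + labWt n p q s j)) • φ (T.basis i) (T.basis j) := by
  refine T.basis.repr.injective <| Finsupp.ext fun k => ?_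
  rw [repr_lie_of_diagonal T.basis (lie_Q_basis hT s), map_smul, Finsupp.smul_apply, smul_eq_mul]
  by_cases hk : T.basis.repr (φ (T.basis i) (T.basis j)) k = 0
  · simp [hk]
  · rw [hw i j k hk s]; push_cast; ring

theorem eq_smul_basis_of_repr {ι K V : Type} [Field K] [AddCommGroup V] [Module K V]
    (b : Basis ι K V) (v : V) (k : ι) (h : ∀ l, b.repr v l ≠ 0 → l = k) :
    v = b.repr v k • b k := by
  classical
  refine b.repr.injective <| Finsupp.ext fun l => ?_
  by_cases hl : l = k
  · subst hl; simp
  · simp [not_imp_comm.1 (h l) hl, Ne.symm hl]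

/-- A weight-preserving cochain maps two basis vectors to multiples of the only basis vector
`e_c` of the right weight. -/
theorem exists_smul_E {φ : twoCochain ℂ T.Alg T.Alg} (hw : WeightPreserving p q φ)
    {i j : Lab n} {c : ℕ} (hc : 1 ≤ c ∧ c ≤ n)
    (h0 : ¬ ∀ s, labWt n p q s i + labWt n p q s j = 0)
    (h : ∀ l, 1 ≤ l ∧ l ≤ n → (∀ s, eWt n p q s l = labWt n p q s i + labWt n p q s j) → l = c) :
    ∃ r : ℂ, φ (T.basis i) (T.basis j) = r • T.E c := by
  obtain ⟨m, hm, hE⟩ := exists_basis_eq_E (T := T) hc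
  refine ⟨_, (eq_smul_basis_of_repr T.basis _ (.inl m) fun l hl => ?_).trans (by rw [hE])⟩
  have := hw i j l hl
  rcases l with l | l
  · have := h _ ⟨by omega, l.2⟩ this
    rw [← hm] at this
    exact congrArg _ (Fin.ext (by omega))
  · exact absurd (fun s => (this s).symm) h0

theorem exists_smul_E_of_E {φ : twoCochain ℂ T.Alg T.Alg} (hw : WeightPreserving p q φ)
    {a b c : ℕ} (ha : 1 ≤ a ∧ a ≤ n) (hb : 1 ≤ b ∧ b ≤ n) (hc : 1 ≤ c ∧ c ≤ n)
    (h0 : ¬ ∀ s, eWt n p q s a + eWt n p q s b = 0)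
    (h : ∀ l, 1 ≤ l ∧ l ≤ n → (∀ s, eWt n p q s l = eWt n p q s a + eWt n p q s b) → l = c) :
    ∃ r : ℂ, φ (T.E a) (T.E b) = r • T.E c := by
  obtain ⟨i, rfl, hi⟩ := exists_basis_eq_E (T := T) ha
  obtain ⟨j, rfl, hj⟩ := exists_basis_eq_E (T := T) hb
  rw [← hi, ← hj]
  exact exists_smul_E hw hc h0 h

/-- A weight-preserving cochain vanishes on `e_a`, `e_b` if there is no basis vector of the
right weight. -/
theorem cochain_E_E_eq_zero {φ : twoCochain ℂ T.Alg T.Alg} (hw : WeightPreserving p q φ)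
    {a b : ℕ} (ha : 1 ≤ a ∧ a ≤ n) (hb : 1 ≤ b ∧ b ≤ n)
    (h0 : ¬ ∀ s, eWt n p q s a + eWt n p q s b = 0)
    (h : ∀ l, 1 ≤ l ∧ l ≤ n → ¬ ∀ s, eWt n p q s l = eWt n p q s a + eWt n p q s b) :
    φ (T.E a) (T.E b) = 0 := by
  obtain ⟨i, rfl, hi⟩ := exists_basis_eq_E (T := T) ha
  obtain ⟨j, rfl, hj⟩ := exists_basis_eq_E (T := T) hb
  rw [← hi, ← hj]
  refine T.basis.repr.injective <| Finsupp.ext fun l => ?_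
  rw [map_zero, Finsupp.zero_apply]
  by_contra hl
  have := hw _ _ l hl
  rcases l with l | l
  · exact h _ ⟨by omega, l.2⟩ this
  · exact h0 fun s => (this s).symm

/-! ### Diagonal maps and the reduction to the nilradical -/

/-- The linear map with `e_k ↦ μ k • e_k` and `x ↦ t 0`, `y ↦ t 1`. -/
noncomputable def diagMap (T : LieTable (Lab n)) (μ : ℕ → ℂ) (t : Fin 2 → T.Alg) :
    T.Alg →ₗ[ℂ] T.Alg :=
  T.basis.constr ℂ (Sum.elim (fun i => μ (i + 1) • T.E (i + 1)) t)

theorem diagMap_E (μ : ℕ → ℂ) (t : Fin 2 → T.Alg) {k : ℕ} (hk : 1 ≤ k ∧ k ≤ n) :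
    diagMap T μ t (T.E k) = μ k • T.E k := by
  obtain ⟨i, rfl, hi⟩ := exists_basis_eq_E (T := T) hk
  rw [← hi, diagMap, Basis.constr_basis, hi]
  rfl

theorem diagMap_Q (μ : ℕ → ℂ) (t : Fin 2 → T.Alg) (s : Fin 2) :
    diagMap T μ t (T.Q s) = t s := by
  rw [← basis_inr, diagMap, Basis.constr_basis]
  rfl

/-- A weight-preserving cocycle vanishes on `x`, `y`. -/
theorem cocycle_Q_Q_eq_zero (hn : 5 ≤ n) (hT : T.listed = listedTable n nil p q)
    (hne : ∀ k, 1 ≤ k ∧ k ≤ n → ¬ ∀ s, eWt n p q s k = 0)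
    {φ : twoCochain ℂ T.Alg T.Alg} (hφ : φ ∈ twoCocycle ℂ T.Alg T.Alg)
    (hw : WeightPreserving p q φ) (s t : Fin 2) : φ (T.Q s) (T.Q t) = 0 := by
  -- In the cocycle identity on two torus vectors and `e_k`, all other terms cancel because `φ`
  -- preserves weights.
  have key : ∀ k, 1 ≤ k ∧ k ≤ n → ⁅T.E k, φ (T.Q s) (T.Q t)⁆ = 0 := by
    intro k hk
    obtain ⟨i, rfl, hi⟩ := exists_basis_eq_E (T := T) hk
    have h := cocycle_apply hφ (T.Q s) (T.Q t) (T.basis (.inl i))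
    have h1 := lie_Q_cochain hT hw s (.inr t) (.inl i)
    have h2 := lie_Q_cochain hT hw t (.inr s) (.inl i)
    rw [basis_inr] at h1 h2
    rw [h1, h2, lie_Q_Q hT, lie_Q_basis hT, lie_Q_basis hT, map_smul, map_smul, map_zero,
      LinearMap.smul_apply, LinearMap.smul_apply, LinearMap.zero_apply,
      ← twoCochain_skew φ (T.Q s) (T.basis _), ← twoCochain_skew φ (T.Q t) (T.basis _)] at h
    rw [← hi, ← h]
    simp only [labWt, Sum.elim_inr, Int.cast_zero]
    module
  -- The value has weight zero, and no `e_k` has weight zero.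
  have hsum : φ (T.Q s) (T.Q t) = T.basis.repr (φ (T.Q s) (T.Q t)) (.inr 0) • T.Q 0 +
      T.basis.repr (φ (T.Q s) (T.Q t)) (.inr 1) • T.Q 1 := by
    conv_lhs => rw [← T.basis.sum_repr (φ (T.Q s) (T.Q t))]
    rw [Fintype.sum_sum_type, Finset.sum_eq_zero, zero_add, Fin.sum_univ_two]
    · rfl
    · intro i _
      by_cases hi : T.basis.repr (φ (T.Q s) (T.Q t)) (.inl i) = 0
      · rw [hi, zero_smul]
      · exact absurd (hw (.inr s) (.inr t) (.inl i) hi) (hne _ ⟨by omega, i.2⟩)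
  -- The weights of `e_1` and `e_2` are `(1, 0)` and `(0, 1)`, so they detect the two coefficients
  -- separately.
  have h1 := key 1 (by omega)
  have h2 := key 2 (by omega)
  rw [hsum, lie_add, lie_smul, lie_smul, lie_E_Q hT (by omega), lie_E_Q hT (by omega),
    smul_smul, smul_smul, ← add_smul] at h1 h2
  have h1 := (smul_eq_zero.1 h1).resolve_right (E_ne_zero (by omega))
  have h2 := (smul_eq_zero.1 h2).resolve_right (E_ne_zero (by omega))
  simp [eWt] at h1
  simp [eWt, show ¬ 2 = n by omega] at h2
  rw [hsum, h1, h2, zero_smul, zero_smul, add_zero]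

/-- A weight-preserving cocycle is additive on brackets, as a function of the basis vectors
`e_k`, when it is contracted with `x` or `y`. -/
theorem cocycle_E_Q_additive (hT : T.listed = listedTable n nil p q)
    {φ : twoCochain ℂ T.Alg T.Alg} (hφ : φ ∈ twoCocycle ℂ T.Alg T.Alg)
    (hw : WeightPreserving p q φ) (s : Fin 2) {γ : ℕ → ℂ}
    (hγ : ∀ k, 1 ≤ k ∧ k ≤ n → φ (T.E k) (T.Q s) = γ k • T.E k)
    {a b c : ℕ} (ha : 1 ≤ a ∧ a ≤ n) (hb : 1 ≤ b ∧ b ≤ n) (hc : 1 ≤ c ∧ c ≤ n) {r : ℂ}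
    (hr : r ≠ 0) (h : ⁅T.E a, T.E b⁆ = r • T.E c) : γ c = γ a + γ b := by
  have h1 := cocycle_apply hφ (T.E a) (T.E b) (T.Q s)
  rw [hγ a ha, hγ b hb, lie_smul, lie_smul, ← lie_skew (T.E b) (T.E a), h, lie_E_Q hT ha,
    lie_E_Q hT hb, map_smul, map_smul, map_smul, LinearMap.smul_apply, LinearMap.smul_apply,
    LinearMap.smul_apply, hγ c hc, ← twoCochain_skew φ (T.E a) (T.E b)] at h1
  obtain ⟨i, rfl, hi⟩ := exists_basis_eq_E (T := T) ha
  obtain ⟨j, rfl, hj⟩ := exists_basis_eq_E (T := T) hb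
  -- The three terms that contain `φ(e_a, e_b)` cancel by weights; the rest says that `γ` is a
  -- diagonal derivation.
  have h2 := lie_Q_cochain hT hw s (.inl i) (.inl j)
  rw [hi, hj] at h2
  rw [h2] at h1
  simp only [labWt, Sum.elim_inl] at h1
  have h3 : (r * (γ (i + 1) + γ (j + 1) - γ c)) • T.E c = 0 := by
    rw [← h1]; module
  have h4 := ((smul_eq_zero.1 h3).resolve_right (E_ne_zero hc))
  linear_combination -((mul_eq_zero.1 h4).resolve_left hr)

/-- The adjoint second cohomology of the algebra of a table vanishes if the weights of the `e_k`
are distinct and nonzero, if they are the only additive functions, and if every weight-preserving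
cocycle is the coboundary of a diagonal map on the nilradical. -/
theorem subsingleton_of_nilradical (hn : 5 ≤ n) (hT : T.listed = listedTable n nil p q)
    (hne : ∀ k, 1 ≤ k ∧ k ≤ n → ¬ ∀ s, eWt n p q s k = 0)
    (hinj : ∀ k l, 1 ≤ k ∧ k ≤ n → 1 ≤ l ∧ l ≤ n →
      (∀ s, eWt n p q s k = eWt n p q s l) → k = l)
    (hadd : ∀ γ : ℕ → ℂ, (∀ a b c, 1 ≤ a ∧ a ≤ n → 1 ≤ b ∧ b ≤ n → 1 ≤ c ∧ c ≤ n →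
      ∀ r : ℂ, r ≠ 0 → ⁅T.E a, T.E b⁆ = r • T.E c → γ c = γ a + γ b) →
      ∀ k, 1 ≤ k ∧ k ≤ n → γ k = γ 1 * eWt n p q 0 k + γ 2 * eWt n p q 1 k)
    (hnil : ∀ φ ∈ twoCocycle ℂ T.Alg T.Alg, WeightPreserving p q φ → ∃ μ : ℕ → ℂ,
      ∀ t a b, 1 ≤ a → a < b → b ≤ n →
        φ (T.E a) (T.E b) = d₁₂ ℂ T.Alg T.Alg (diagMap T μ t) (T.E a) (T.E b)) :
    Subsingleton (AdjointH2 ℂ T.Alg) := by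
  refine subsingleton_of_weightPreserving hT fun φ hφ hw => ?_
  obtain ⟨μ, hμ⟩ := hnil φ hφ hw
  have hex : ∀ s k, ∃ r : ℂ, 1 ≤ k ∧ k ≤ n → φ (T.E k) (T.Q s) = r • T.E k := by
    intro s k
    by_cases hk : 1 ≤ k ∧ k ≤ n
    · obtain ⟨i, rfl, hi⟩ := exists_basis_eq_E (T := T) hk
      obtain ⟨r, hr⟩ := exists_smul_E (T := T) hw (i := .inl i) (j := .inr s) hk
        (by simpa [labWt] using hne _ hk)
        (fun l hl h => hinj _ _ hl hk (by simpa [labWt] using h))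
      exact ⟨r, fun _ => by rw [← hr, ← hi]; rfl⟩
    · exact ⟨0, fun h => absurd h hk⟩
  choose γ hγ using hex
  -- By additivity, bracketing `e_k` with `t s` multiplies it by `γ s k`. The contribution of `μ` to
  -- the coboundary on `e_k` and a torus vector cancels, and `t` does not affect the coboundary on
  -- the nilradical, so the two choices are independent.
  let t : Fin 2 → T.Alg := fun s => γ s 1 • T.Q 0 + γ s 2 • T.Q 1
  have hEQ : ∀ s k, 1 ≤ k ∧ k ≤ n →
      φ (T.E k) (T.Q s) = d₁₂ ℂ T.Alg T.Alg (diagMap T μ t) (T.E k) (T.Q s) := by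
    intro s k hk
    have h1 := hadd (γ s) (fun a b c ha hb hc r hr h =>
      cocycle_E_Q_additive hT hφ hw s (hγ s) ha hb hc hr h) k hk
    rw [hγ s k hk, d₁₂_apply_apply, diagMap_Q, diagMap_E μ t hk, lie_smul,
      ← lie_skew (T.Q s) (T.E k), lie_E_Q hT hk, map_smul, diagMap_E μ t hk, h1]
    simp only [t, lie_add, lie_smul, lie_E_Q hT hk]
    module
  refine ⟨diagMap T μ t, ?_⟩
  rintro (i | s) (j | s')
  · rw [basis_inl, basis_inl]
    rcases lt_trichotomy i j with h | h | h
    · exact hμ t _ _ (by omega) (by simpa using h) j.2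
    · rw [h, twoCochain_alt, twoCochain_alt]
    · rw [← twoCochain_skew φ (T.E (j + 1)), ← twoCochain_skew _ (T.E (j + 1)),
        hμ t _ _ (by omega) (by simpa using h) i.2]
  · rw [basis_inl, basis_inr, hEQ _ _ ⟨by omega, i.2⟩]
  · rw [basis_inl, basis_inr, ← twoCochain_skew φ (T.E (j + 1)),
      ← twoCochain_skew _ (T.E (j + 1)), hEQ _ _ ⟨by omega, j.2⟩]
  · rw [basis_inr, basis_inr, cocycle_Q_Q_eq_zero hn hT hne hφ hw, d₁₂_apply_apply, diagMap_Q,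
      diagMap_Q, lie_Q_Q hT, map_zero]
    simp [t, lie_Q_Q hT]

end

/-! ### Functions along the chain `e_2, e_3, …` -/

theorem additive_on_chain {n : ℕ} {γ : ℕ → ℂ}
    (h : ∀ i, 2 ≤ i → i + 2 ≤ n → γ (i + 1) = γ 1 + γ i) (k : ℕ) (hk : 2 ≤ k) (hkn : k + 1 ≤ n) :
    γ k = γ 1 * ((k : ℂ) - 2) + γ 2 := by
  induction k, hk using Nat.le_induction with
  | base => push_cast; ring
  | succ k hk ih => rw [h k hk (by omega), ih (by omega)]; push_cast; ring

/-- The potential of the coefficients `α` along the chain `e_2, e_3, …`. -/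
noncomputable def potential (α : ℕ → ℂ) (k : ℕ) : ℂ := -∑ j ∈ Finset.Ico 2 k, α j

theorem potential_succ (α : ℕ → ℂ) {k : ℕ} (hk : 2 ≤ k) :
    potential α (k + 1) = potential α k - α k := by
  rw [potential, Finset.sum_Ico_succ_top hk, potential]; ring

theorem potential_one (α : ℕ → ℂ) : potential α 1 = 0 := by simp [potential]

theorem potential_two (α : ℕ → ℂ) : potential α 2 = 0 := by simp [potential]

/-! ### The algebra `R(g²_{(n,1)}, 2)` -/

section R2

variable {n : ℕ} {hn : 5 ≤ n}

theorem R2_listed : (R2 n hn).listed = listedTable n (nil2 n) (2 : ℤ) (0 : ℤ) := by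
  simp [R2, listed2]

theorem R2_lie {a b : ℕ} (ha : 1 ≤ a) (hab : a < b) (hb : b ≤ n) :
    ⁅(R2 n hn).E a, (R2 n hn).E b⁆ =
      if a = 1 ∧ b + 2 ≤ n then (R2 n hn).E (b + 1)
      else if 2 ≤ a ∧ a + 3 ≤ n ∧ b = n then (R2 n hn).E (a + 2) else 0 := by
  rw [lie_E_E R2_listed (by omega) (by omega), nil2_sub n a b hn]
  split_ifs <;> first | (exfalso; omega) | rfl

theorem R2_lie_one {i : ℕ} (hi : 2 ≤ i) (hin : i + 2 ≤ n) :
    ⁅(R2 n hn).E 1, (R2 n hn).E i⁆ = (R2 n hn).E (i + 1) := by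
  rw [R2_lie (by omega) (by omega) (by omega), if_pos (by omega)]

theorem R2_lie_last {i : ℕ} (hi : 2 ≤ i) (hin : i + 3 ≤ n) :
    ⁅(R2 n hn).E i, (R2 n hn).E n⁆ = (R2 n hn).E (i + 2) := by
  rw [R2_lie (by omega) (by omega) (by omega), if_neg (by omega), if_pos (by omega)]

theorem R2_additive (γ : ℕ → ℂ)
    (h : ∀ a b c, 1 ≤ a ∧ a ≤ n → 1 ≤ b ∧ b ≤ n → 1 ≤ c ∧ c ≤ n → ∀ r : ℂ, r ≠ 0 →
      ⁅(R2 n hn).E a, (R2 n hn).E b⁆ = r • (R2 n hn).E c → γ c = γ a + γ b)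
    (k : ℕ) (hk : 1 ≤ k ∧ k ≤ n) : γ k = γ 1 * eWt n 2 0 0 k + γ 2 * eWt n 2 0 1 k := by
  have hchain := additive_on_chain (n := n) (γ := γ) fun i hi hin =>
    h 1 i (i + 1) (by omega) (by omega) (by omega) 1 one_ne_zero
      (by rw [R2_lie_one hi hin, one_smul])
  -- The chain stops at `e_{n-1}`; the value at `n` comes from `[e_2, e_n] = e_4`.
  have h4 := h 2 n 4 (by omega) (by omega) (by omega) 1 one_ne_zero
    (by rw [R2_lie_last le_rfl (by omega), one_smul])
  have h4' := hchain 4 (by omega) (by omega)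
  rw [eWt_zero, eWt_one]
  split_ifs with h1 h2
  · subst h1; simp
  · subst h2
    push_cast at h4' ⊢
    linear_combination h4' - h4
  · rw [hchain k (by omega) (by omega)]; push_cast; ring

theorem R2_cochain_one {φ : twoCochain ℂ (R2 n hn).Alg (R2 n hn).Alg}
    (hw : WeightPreserving 2 0 φ) {i : ℕ} (hi : 2 ≤ i) (hin : i + 2 ≤ n) :
    ∃ r : ℂ, φ ((R2 n hn).E 1) ((R2 n hn).E i) = r • (R2 n hn).E (i + 1) := by
  refine exists_smul_E_of_E hw (by omega) (by omega) (by omega) (fun h => ?_) (fun l hl h => ?_) <;>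
  · have h0 := h 0
    have h1 := h 1
    simp only [eWt_zero, eWt_one] at h0 h1
    split_ifs at h0 h1 <;> omega

theorem R2_cochain_last {φ : twoCochain ℂ (R2 n hn).Alg (R2 n hn).Alg}
    (hw : WeightPreserving 2 0 φ) {i : ℕ} (hi : 2 ≤ i) (hin : i + 3 ≤ n) :
    ∃ r : ℂ, φ ((R2 n hn).E i) ((R2 n hn).E n) = r • (R2 n hn).E (i + 2) := by
  refine exists_smul_E_of_E hw (by omega) (by omega) (by omega) (fun h => ?_) (fun l hl h => ?_) <;>
  · have h0 := h 0
    have h1 := h 1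
    simp only [eWt_zero, eWt_one] at h0 h1
    split_ifs at h0 h1 <;> omega

/-- For `2 ≤ a < b < n` the `y`-weight of the pair is 2, which does not occur. The pair `e_1, e_n`
has weight `(3, 0)`, which does not occur either. The remaining pairs have `y`-weight 1 and
`x`-weight at least `n - 2`, while the chain ends at `x`-weight `n - 3`. -/
theorem R2_cochain_zero {φ : twoCochain ℂ (R2 n hn).Alg (R2 n hn).Alg}
    (hw : WeightPreserving 2 0 φ) {a b : ℕ} (ha : 1 ≤ a) (hab : a < b) (hb : b ≤ n)
    (h1 : ¬ (a = 1 ∧ b + 2 ≤ n)) (h2 : ¬ (2 ≤ a ∧ a + 3 ≤ n ∧ b = n)) :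
    φ ((R2 n hn).E a) ((R2 n hn).E b) = 0 := by
  refine cochain_E_E_eq_zero hw (by omega) (by omega) (fun h => ?_) (fun l hl h => ?_) <;>
  · have h0 := h 0
    have h1 := h 1
    simp only [eWt_zero, eWt_one] at h0 h1
    split_ifs at h0 h1 <;> omega

/-- The recursion for the coefficients of a weight-preserving cocycle. -/
theorem R2_recursion {φ : twoCochain ℂ (R2 n hn).Alg (R2 n hn).Alg}
    (hφ : φ ∈ twoCocycle ℂ (R2 n hn).Alg (R2 n hn).Alg) (hw : WeightPreserving 2 0 φ)
    {α β : ℕ → ℂ}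
    (hα : ∀ i, 2 ≤ i → i + 2 ≤ n →
      φ ((R2 n hn).E 1) ((R2 n hn).E i) = α i • (R2 n hn).E (i + 1))
    (hβ : ∀ i, 2 ≤ i → i + 3 ≤ n →
      φ ((R2 n hn).E i) ((R2 n hn).E n) = β i • (R2 n hn).E (i + 2))
    {i : ℕ} (hi : 2 ≤ i) (hin : i + 4 ≤ n) : β (i + 1) = β i - α i + α (i + 2) := by
  have h := cocycle_apply hφ ((R2 n hn).E 1) ((R2 n hn).E i) ((R2 n hn).E n)
  have h1n : ⁅(R2 n hn).E 1, (R2 n hn).E n⁆ = 0 := by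
    rw [R2_lie (by omega) (by omega) (by omega), if_neg (by omega), if_neg (by omega)]
  rw [hβ i hi (by omega), hα i hi (by omega), h1n,
    R2_cochain_zero hw (a := 1) (b := n) (by omega) (by omega) (by omega) (by omega) (by omega),
    R2_lie_one hi (by omega), R2_lie_last hi (by omega), hβ (i + 1) (by omega) (by omega),
    ← twoCochain_skew φ ((R2 n hn).E 1), hα (i + 2) (by omega) (by omega), lie_smul, lie_smul,
    R2_lie_one (i := i + 2) (by omega) (by omega), ← lie_skew ((R2 n hn).E n),
    R2_lie_last (i := i + 1) (by omega) (by omega), map_zero, LinearMap.zero_apply, lie_zero] at h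
  have h3 : (β i - α i - β (i + 1) + α (i + 2)) • (R2 n hn).E (i + 3) = 0 := by
    rw [← h]; module
  linear_combination -(smul_eq_zero.1 h3).resolve_right (E_ne_zero (by omega))

/-- A diagonal map `μ` has coboundary coefficients `μ 1 + μ b - μ (b + 1)` on `e_1, e_b` and `μ a +
μ n - μ (a + 2)` on `e_a, e_n`. The first family is solved by the potential of `α`; the second
leaves only `μ n` free. -/
theorem R2_coboundary {φ : twoCochain ℂ (R2 n hn).Alg (R2 n hn).Alg}
    (hφ : φ ∈ twoCocycle ℂ (R2 n hn).Alg (R2 n hn).Alg) (hw : WeightPreserving 2 0 φ) :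
    ∃ μ : ℕ → ℂ, ∀ t a b, 1 ≤ a → a < b → b ≤ n →
      φ ((R2 n hn).E a) ((R2 n hn).E b) =
        d₁₂ ℂ (R2 n hn).Alg (R2 n hn).Alg (diagMap (R2 n hn) μ t) ((R2 n hn).E a)
          ((R2 n hn).E b) := by
  choose! α hα using fun i (hi : 2 ≤ i) (hin : i + 2 ≤ n) => R2_cochain_one hw hi hin
  choose! β hβ using fun i (hi : 2 ≤ i) (hin : i + 3 ≤ n) => R2_cochain_last hw hi hin
  -- By the recursion, `β i` and `potential α i - potential α (i + 2)` have the same increments, so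
  -- their difference is constant.
  have hβ' : ∀ i, 2 ≤ i → i + 3 ≤ n →
      β i = β 2 + potential α 4 + potential α i - potential α (i + 2) := by
    intro i hi
    induction i, hi using Nat.le_induction with
    | base => intro _; rw [potential_two]; ring
    | succ i hi ih =>
      intro hin
      rw [R2_recursion hφ hw hα hβ hi (by omega), ih (by omega),
        potential_succ α (k := i) (by omega), show i + 1 + 2 = i + 2 + 1 by ring,
        potential_succ α (k := i + 2) (by omega)]
      ring
  -- The value at `n` is forced by the pair `e_2, e_n`.
  refine ⟨fun k => if k = n then β 2 + potential α 4 else potential α k, fun t a b ha hab hb => ?_⟩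
  rw [d₁₂_apply_apply, diagMap_E _ _ (by omega), diagMap_E _ _ (by omega), lie_smul, lie_smul,
    ← lie_skew ((R2 n hn).E b), if_neg (show ¬ a = n by omega)]
  by_cases h1 : a = 1 ∧ b + 2 ≤ n
  · obtain ⟨rfl, h1⟩ := h1
    rw [hα b (by omega) h1, R2_lie_one (by omega) h1, diagMap_E _ _ (by omega),
      if_neg (show ¬ b = n by omega), if_neg (show ¬ b + 1 = n by omega),
      potential_succ α (k := b) (by omega), potential_one]
    module
  by_cases h2 : 2 ≤ a ∧ a + 3 ≤ n ∧ b = n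
  · obtain ⟨h2, h3, h4⟩ := h2
    rw [h4, hβ a h2 h3, R2_lie_last h2 h3, diagMap_E _ _ (by omega), if_pos rfl,
      if_neg (show ¬ a + 2 = n by omega), hβ' a h2 h3]
    module
  rw [R2_cochain_zero hw ha hab hb h1 h2, R2_lie ha hab hb, if_neg h1, if_neg h2]
  simp

theorem R2_subsingleton (n : ℕ) (hn : 5 ≤ n) : Subsingleton (AdjointH2 ℂ (R2 n hn).Alg) := by
  refine subsingleton_of_nilradical hn R2_listed (fun k hk h => ?_) (fun k l hk hl h => ?_)
    R2_additive fun φ hφ hw => R2_coboundary hφ hw <;>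
  · have h0 := h 0
    have h1 := h 1
    simp only [eWt_zero, eWt_one] at h0 h1
    split_ifs at h0 h1 <;> omega

end R2

/-! ### The algebra `R(g¹_{(n,1)}, 2)` -/

section R1

variable {n : ℕ} {hn : 5 ≤ n} {hodd : Odd n}

theorem R1_listed :
    (R1 n hn hodd).listed = listedTable n (nil1 n) (((n : ℤ) - 4 : ℤ) : ℂ) (2 : ℤ) := by
  simp [R1, listed1]

theorem R1_lie {a b : ℕ} (ha : 1 ≤ a ∧ a ≤ n) (hb : 1 ≤ b ∧ b ≤ n) :
    ⁅(R1 n hn hodd).E a, (R1 n hn hodd).E b⁆ =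
      if a = 1 ∧ 2 ≤ b ∧ b + 2 ≤ n then (R1 n hn hodd).E (b + 1)
      else if b = 1 ∧ 2 ≤ a ∧ a + 2 ≤ n then -(R1 n hn hodd).E (a + 1)
      else if 2 ≤ a ∧ 2 ≤ b ∧ a + b = n then (-1 : ℂ) ^ a • (R1 n hn hodd).E n else 0 := by
  rw [lie_E_E R1_listed ha hb, nil1_sub n a b hodd]
  split_ifs <;> rfl

theorem R1_lie_one {i : ℕ} (hi : 2 ≤ i) (hin : i + 2 ≤ n) :
    ⁅(R1 n hn hodd).E 1, (R1 n hn hodd).E i⁆ = (R1 n hn hodd).E (i + 1) := by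
  rw [R1_lie (by omega) (by omega), if_pos (by omega)]

theorem R1_lie_last {i j : ℕ} (hi : 2 ≤ i) (hj : 2 ≤ j) (hij : i + j = n) :
    ⁅(R1 n hn hodd).E i, (R1 n hn hodd).E j⁆ = (-1 : ℂ) ^ i • (R1 n hn hodd).E n := by
  rw [R1_lie (by omega) (by omega), if_neg (by omega), if_neg (by omega), if_pos (by omega)]

theorem R1_additive (γ : ℕ → ℂ)
    (h : ∀ a b c, 1 ≤ a ∧ a ≤ n → 1 ≤ b ∧ b ≤ n → 1 ≤ c ∧ c ≤ n → ∀ r : ℂ, r ≠ 0 →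
      ⁅(R1 n hn hodd).E a, (R1 n hn hodd).E b⁆ = r • (R1 n hn hodd).E c → γ c = γ a + γ b)
    (k : ℕ) (hk : 1 ≤ k ∧ k ≤ n) :
    γ k = γ 1 * eWt n ((n : ℤ) - 4) 2 0 k + γ 2 * eWt n ((n : ℤ) - 4) 2 1 k := by
  have hchain := additive_on_chain (n := n) (γ := γ) fun i hi hin =>
    h 1 i (i + 1) (by omega) (by omega) (by omega) 1 one_ne_zero
      (by rw [R1_lie_one hi hin, one_smul])
  -- The vector `e_n` lies off the chain; its value comes from `[e_2, e_{n-2}] = e_n`.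
  have hlast := h 2 (n - 2) n (by omega) (by omega) (by omega) ((-1) ^ 2) (by simp)
    (R1_lie_last le_rfl (by omega) (by omega))
  have hlast' := hchain (n - 2) (by omega) (by omega)
  rw [eWt_zero, eWt_one]
  split_ifs with h1 h2
  · subst h1; simp
  · subst h2
    push_cast [show 2 ≤ k by omega] at hlast' ⊢
    linear_combination hlast + hlast'
  · rw [hchain k (by omega) (by omega)]; push_cast; ring

theorem R1_cochain_one {φ : twoCochain ℂ (R1 n hn hodd).Alg (R1 n hn hodd).Alg}
    (hw : WeightPreserving ((n : ℤ) - 4) 2 φ) {i : ℕ} (hi : 2 ≤ i) (hin : i + 2 ≤ n) :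
    ∃ r : ℂ, φ ((R1 n hn hodd).E 1) ((R1 n hn hodd).E i) = r • (R1 n hn hodd).E (i + 1) := by
  refine exists_smul_E_of_E hw (by omega) (by omega) (by omega) (fun h => ?_) (fun l hl h => ?_) <;>
  · have h0 := h 0
    have h1 := h 1
    simp only [eWt_zero, eWt_one] at h0 h1
    split_ifs at h0 h1 <;> omega

theorem R1_cochain_last {φ : twoCochain ℂ (R1 n hn hodd).Alg (R1 n hn hodd).Alg}
    (hw : WeightPreserving ((n : ℤ) - 4) 2 φ) {i j : ℕ} (hi : 2 ≤ i) (hj : 2 ≤ j)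
    (hij : i + j = n) :
    ∃ r : ℂ, φ ((R1 n hn hodd).E i) ((R1 n hn hodd).E j) = r • (R1 n hn hodd).E n := by
  refine exists_smul_E_of_E hw (by omega) (by omega) (by omega) (fun h => ?_) (fun l hl h => ?_) <;>
  · have h0 := h 0
    have h1 := h 1
    simp only [eWt_zero, eWt_one] at h0 h1
    split_ifs at h0 h1 <;> omega

/-- Only `e_n` has `y`-weight 2, and its `x`-weight `n - 4` requires `a + b = n` for `2 ≤ a < b <
n`. The pairs `e_1, e_{n-1}` and `e_1, e_n` overshoot the `x`-weights available, and `e_a, e_n` with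
`2 ≤ a < n` has `y`-weight 3. -/
theorem R1_cochain_zero {φ : twoCochain ℂ (R1 n hn hodd).Alg (R1 n hn hodd).Alg}
    (hw : WeightPreserving ((n : ℤ) - 4) 2 φ) {a b : ℕ} (ha : 1 ≤ a) (hab : a ≤ b) (hb : b ≤ n)
    (h1 : ¬ (a = 1 ∧ 2 ≤ b ∧ b + 2 ≤ n)) (h2 : ¬ (2 ≤ a ∧ 2 ≤ b ∧ a + b = n)) :
    φ ((R1 n hn hodd).E a) ((R1 n hn hodd).E b) = 0 := by
  -- Equality is admitted because the recursion meets it at `i = j = (n - 1) / 2`.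
  rcases hab.eq_or_lt with rfl | hab
  · exact twoCochain_alt φ _
  refine cochain_E_E_eq_zero hw (by omega) (by omega) (fun h => ?_) (fun l hl h => ?_) <;>
  · have h0 := h 0
    have h1 := h 1
    simp only [eWt_zero, eWt_one] at h0 h1
    split_ifs at h0 h1 <;> omega

/-- The recursion for the coefficients of a weight-preserving cocycle. -/
theorem R1_recursion {φ : twoCochain ℂ (R1 n hn hodd).Alg (R1 n hn hodd).Alg}
    (hφ : φ ∈ twoCocycle ℂ (R1 n hn hodd).Alg (R1 n hn hodd).Alg)
    (hw : WeightPreserving ((n : ℤ) - 4) 2 φ) {α β : ℕ → ℂ}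
    (hα : ∀ i, 2 ≤ i → i + 2 ≤ n →
      φ ((R1 n hn hodd).E 1) ((R1 n hn hodd).E i) = α i • (R1 n hn hodd).E (i + 1))
    (hβ : ∀ i j, 2 ≤ i → 2 ≤ j → i + j = n →
      φ ((R1 n hn hodd).E i) ((R1 n hn hodd).E j) = β i • (R1 n hn hodd).E n)
    {i j : ℕ} (hi : 2 ≤ i) (hj : 2 ≤ j) (hij : i + 1 + j = n) :
    β (i + 1) = -β i + (-1) ^ i * (α i - α j) := by
  have h := cocycle_apply hφ ((R1 n hn hodd).E 1) ((R1 n hn hodd).E i) ((R1 n hn hodd).E j)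
  have hφij : φ ((R1 n hn hodd).E i) ((R1 n hn hodd).E j) = 0 := by
    rcases le_total i j with hle | hle
    · exact R1_cochain_zero hw (by omega) hle (by omega) (by omega) (by omega)
    · rw [← twoCochain_skew φ ((R1 n hn hodd).E j), R1_cochain_zero hw (by omega) hle (by omega)
        (by omega) (by omega), neg_zero]
  have hlie : ⁅(R1 n hn hodd).E i, (R1 n hn hodd).E j⁆ = 0 := by
    rw [R1_lie (by omega) (by omega), if_neg (by omega), if_neg (by omega), if_neg (by omega)]
  -- Here `i + j = n - 1` is even, so `i` and `j` have the same parity.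
  have hpow : (-1 : ℂ) ^ j = (-1) ^ i := by
    obtain ⟨m, hm⟩ := hodd
    rcases Nat.even_or_odd i with he | he
    · rw [he.neg_one_pow, Even.neg_one_pow (by grind)]
    · rw [he.neg_one_pow, Odd.neg_one_pow (by grind)]
  rw [hφij, hlie, hα i hi (by omega), hα j hj (by omega), R1_lie_one hi (by omega),
    R1_lie_one hj (by omega), hβ (i + 1) j (by omega) hj hij,
    ← twoCochain_skew φ ((R1 n hn hodd).E i) ((R1 n hn hodd).E (j + 1)),
    hβ i (j + 1) hi (by omega) (by omega), lie_smul, lie_smul,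
    R1_lie_last hi (by omega) (by omega), R1_lie_last hj (by omega) (by omega), hpow, map_zero,
    LinearMap.zero_apply, lie_zero] at h
  have h3 : ((-1) ^ i * (α i - α j) - β (i + 1) - β i) • (R1 n hn hodd).E n = 0 := by
    rw [← h]; module
  linear_combination -(smul_eq_zero.1 h3).resolve_right (E_ne_zero (by omega))

/-- On `e_i, e_j` with `i, j ≥ 2` and `i + j = n`, the coboundary of a diagonal map `μ` has
coefficient `(-1)^i (μ i + μ j - μ n)`. The potential of `α` settles the brackets with `e_1`, and `μ
n` is fixed by the pair `e_2, e_{n-2}`. -/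
theorem R1_coboundary {φ : twoCochain ℂ (R1 n hn hodd).Alg (R1 n hn hodd).Alg}
    (hφ : φ ∈ twoCocycle ℂ (R1 n hn hodd).Alg (R1 n hn hodd).Alg)
    (hw : WeightPreserving ((n : ℤ) - 4) 2 φ) :
    ∃ μ : ℕ → ℂ, ∀ t a b, 1 ≤ a → a < b → b ≤ n →
      φ ((R1 n hn hodd).E a) ((R1 n hn hodd).E b) =
        d₁₂ ℂ (R1 n hn hodd).Alg (R1 n hn hodd).Alg (diagMap (R1 n hn hodd) μ t)
          ((R1 n hn hodd).E a) ((R1 n hn hodd).E b) := by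
  choose! α hα using fun i (hi : 2 ≤ i) (hin : i + 2 ≤ n) => R1_cochain_one hw hi hin
  -- As `j = n - i`, the coefficient depends on `i` alone. It is taken for all `i` from 2 to `n -
  -- 2`, not only the first half, so that the recursion runs without a case split.
  have hex : ∀ i, ∃ r : ℂ, ∀ j, 2 ≤ i → 2 ≤ j → i + j = n →
      φ ((R1 n hn hodd).E i) ((R1 n hn hodd).E j) = r • (R1 n hn hodd).E n := by
    intro i
    by_cases hi : 2 ≤ i ∧ i + 2 ≤ n
    · obtain ⟨r, hr⟩ := R1_cochain_last (j := n - i) hw hi.1 (by omega) (by omega)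
      refine ⟨r, fun j _ _ hij => ?_⟩
      rw [← hr, show j = n - i by omega]
    · exact ⟨0, fun j _ _ hij => absurd hij (by omega)⟩
  choose β hβ using hex
  have hβ' : ∀ i j, 2 ≤ i → 2 ≤ j → i + j = n →
      β i = (-1) ^ i * (potential α i + potential α j - (potential α (n - 2) - β 2)) := by
    intro i j hi
    induction i, hi using Nat.le_induction generalizing j with
    | base => intro hj hij; rw [potential_two, show n - 2 = j by omega]; ring
    | succ i hi ih =>
      intro hj hij
      rw [R1_recursion hφ hw hα hβ hi hj hij, ih (j + 1) (by omega) (by omega),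
        potential_succ α (k := i) (by omega), potential_succ α (k := j) (by omega)]
      ring
  refine ⟨fun k => if k = n then potential α (n - 2) - β 2 else potential α k,
    fun t a b ha hab hb => ?_⟩
  rw [d₁₂_apply_apply, diagMap_E _ _ (by omega), diagMap_E _ _ (by omega), lie_smul, lie_smul,
    ← lie_skew ((R1 n hn hodd).E b), if_neg (show ¬ a = n by omega)]
  by_cases h1 : a = 1 ∧ 2 ≤ b ∧ b + 2 ≤ n
  · obtain ⟨rfl, h1, h1'⟩ := h1
    rw [hα b h1 h1', R1_lie_one h1 h1', diagMap_E _ _ (by omega),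
      if_neg (show ¬ b = n by omega), if_neg (show ¬ b + 1 = n by omega),
      potential_succ α (k := b) (by omega), potential_one]
    module
  by_cases h2 : 2 ≤ a ∧ 2 ≤ b ∧ a + b = n
  · obtain ⟨h2, h3, h4⟩ := h2
    rw [hβ a b h2 h3 h4, R1_lie_last h2 h3 h4, map_smul, diagMap_E _ _ (by omega), if_pos rfl,
      if_neg (show ¬ b = n by omega), hβ' a b h2 h3 h4]
    module
  rw [R1_cochain_zero hw ha hab.le hb h1 h2, R1_lie (by omega) (by omega), if_neg h1,
    if_neg (show ¬ (b = 1 ∧ 2 ≤ a ∧ a + 2 ≤ n) by omega), if_neg h2]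
  simp

theorem R1_subsingleton (n : ℕ) (hn : 5 ≤ n) (hodd : Odd n) :
    Subsingleton (AdjointH2 ℂ (R1 n hn hodd).Alg) := by
  refine subsingleton_of_nilradical hn R1_listed (fun k hk h => ?_) (fun k l hk hl h => ?_)
    R1_additive fun φ hφ hw => R1_coboundary hφ hw <;>
  · have h0 := h 0
    have h1 := h 1
    simp only [eWt_zero, eWt_one] at h0 h1
    split_ifs at h0 h1 <;> omega

end R1

theorem mainTheorem4 :
    (∀ (n : ℕ) (hn : 5 ≤ n) (hodd : Odd n), Subsingleton (AdjointH2 ℂ (R1 n hn hodd).Alg)) ∧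
    (∀ (n : ℕ) (hn : 5 ≤ n), Subsingleton (AdjointH2 ℂ (R2 n hn).Alg)) :=
  ⟨R1_subsingleton, R2_subsingleton⟩
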